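/- Let $n,k$ be positive integers. Let $\mathcal{IS}_n$ be the symmetric inverse semigroup of all partial injections of $\{1,\dots,n\}$ to itself, composed as maps from right to left. It acts on $V=\mathbb{C}^n$ (standard basis $e_1,\dots,e_n$) by rook matrices: $\sigma e_i=e_{\sigma(i)}$ if $\sigma(i)$ is defined, and $\sigma e_i=0$ otherwise. Let $U=V\oplus\mathbb{C}$, where $\mathbb{C}=\mathbb{C}e_0$ is the trivial module (every element acts as the identity), and let $\mathcal{IS}_n$ act diagonally on $U^{\otimes k}$. Let $\mathcal{PI}^*_k$ be the partial dual symmetric inverse semigroup. Its elements are the partitions $\alpha$ of subsets of $\{1,\dots,k,1',\dots,k'\}$ such that each block contains at least one unprimed and at least one primed point. To form $\alpha\beta$, complete both partitions by one-element blocks on the remaining points, identify the primed points of $\alpha$ with the corresponding unprimed points of $\beta$, and form the connected components. The blocks of $\alpha\beta$ are the traces, on the unprimed points of $\alpha$ and the primed points of $\beta$, of those components that contain no one-element block of $\alpha$ or $\beta$. For $\mathbf{i}\in\{0,1,\dots,n\}^k$ put $v_{\mathbf{i}}=e_{i_1}\otimes\dots\otimes e_{i_k}$. Then $\mathcal{PI}^*_k$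 acts on $U^{\otimes k}$ (as a right action) by letting $\alpha$ send $v_{\mathbf{i}}$ to $\sum_{\mathbf{l}}v_{\mathbf{l}}$, the sum over all $\mathbf{l}\in\{0,1,\dots,n\}^k$ such that all the $i_a$ and $l_b$ with $a,b'$ in a common block of $\alpha$ are equal, while $i_a=0$ and $l_b=0$ for all $a$ and $b'$ that lie in no block of $\alpha$ (there is at most one such $\mathbf{l}$; an empty sum is $0$). Then: (i) The actions of $\mathcal{IS}_n$ and $\mathcal{PI}^*_k$ on $U^{\otimes k}$ commute. (ii) $\mathrm{End}_{\mathcal{IS}_n}(U^{\otimes k})$ coincides with the image of $\mathbb{C}[\mathcal{PI}^*_k]$ in $\mathrm{End}_{\mathbb{C}}(U^{\otimes k})$. (iii) $\mathrm{End}_{\mathcal{PI}^*_k}(U^{\otimes k})$ coincides with the image of $\mathbb{C}[\mathcal{IS}_n]$ in $\mathrm{End}_{\mathbb{C}}(U^{\otimes k})$. (iv) The representation of $\mathcal{IS}_n$ on $U^{\otimes k}$ is faithful. (v) The representation of $\mathcal{PI}^*_k$ on $U^{\otimes k}$ is faithful. (vi) The representation of the semigroup algebra $\mathbb{C}[\mathcal{IS}_n]$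 on $U^{\otimes k}$ is faithful if and only if $k\ge n$. (vii) The representation of the semigroup algebra $\mathbb{C}[\mathcal{PI}^*_k]$ on $U^{\otimes k}$ is faithful if and only if $k\le n$. -/

import Mathlib

open scoped TensorProduct

namespace RookDuality

/-! ### The symmetric inverse semigroup and its representation on `U^{⊗k}` -/

/-- The symmetric inverse semigroup: all partial injections of an `n`-element set to itself. -/
def SymInv (n : ℕ) : Type := PEquiv (Fin n) (Fin n)

/-- Composition of partial maps, from right to left. -/
instance (n : ℕ) : Monoid (SymInv n) where
  mul σ τ := PEquiv.trans τ σ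
  one := PEquiv.refl (Fin n)
  mul_assoc σ τ ρ := (PEquiv.trans_assoc ρ τ σ).symm
  one_mul σ := PEquiv.trans_refl σ
  mul_one σ := PEquiv.refl_trans σ

/-- The rook matrix of a partial injection `σ`: the `(j, i)` entry is `1` if `σ i = j`, and
`0` otherwise. -/
def rookMatrix {n : ℕ} (σ : SymInv n) : Matrix (Fin n) (Fin n) ℂ :=
  (PEquiv.toMatrix (α := ℂ) (show PEquiv (Fin n) (Fin n) from σ)).transpose

/-- The natural representation on `V = ℂ^n`, by rook matrices. -/
noncomputable def natRep (n : ℕ) : Representation ℂ (SymInv n) (Fin n → ℂ) where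
  toFun σ := Matrix.mulVecLin (rookMatrix σ)
  map_one' := by
    have h : rookMatrix (1 : SymInv n) = 1 := by
      show (PEquiv.toMatrix (PEquiv.refl (Fin n))).transpose = (1 : Matrix _ _ ℂ)
      rw [PEquiv.toMatrix_refl, Matrix.transpose_one]
    rw [h, Matrix.mulVecLin_one]; rfl
  map_mul' σ τ := by
    have h : rookMatrix (σ * τ) = rookMatrix σ * rookMatrix τ := by
      exact (congrArg Matrix.transpose (PEquiv.toMatrix_trans (α := ℂ)
        (show PEquiv (Fin n) (Fin n) from τ) (show PEquiv (Fin n) (Fin n) from σ))).trans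
        (Matrix.transpose_mul _ _)
    rw [h, Matrix.mulVecLin_mul]; rfl

/-- The space `U = V ⊕ ℂ`. -/
abbrev U (n : ℕ) : Type := (Fin n → ℂ) × ℂ

/-- The module `U = V ⊕ ℂ`, where `ℂ` is the trivial module. -/
noncomputable def repU (n : ℕ) : Representation ℂ (SymInv n) (U n) :=
  (natRep n).prod (Representation.trivial ℂ (SymInv n) ℂ)

/-- The tensor power `U^{⊗k}`. -/
abbrev TensorU (n k : ℕ) : Type := ⨂[ℂ] _ : Fin k, U n

/-- The diagonal action of the symmetric inverse semigroup on `U^{⊗k}`. -/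
noncomputable def leftRep (n k : ℕ) : Representation ℂ (SymInv n) (TensorU n k) where
  toFun σ := PiTensorProduct.map fun _ : Fin k => repU n σ
  map_one' := by simp only [map_one]; exact PiTensorProduct.map_one
  map_mul' σ τ := by
    simp only [map_mul]; exact PiTensorProduct.map_mul (fun _ => repU n σ) (fun _ => repU n τ)

/-! ### The partial dual symmetric inverse semigroup -/

/-- The `2k` points `1, …, k` (`Sum.inl`) and `1', …, k'` (`Sum.inr`). -/
abbrev Pt (k : ℕ) : Type := Fin k ⊕ Fin k

/-- An element of the partial dual symmetric inverse semigroup: a partition of a subset of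
`{1, …, k, 1', …, k'}` every block of which contains both an unprimed and a primed point. -/
@[ext]
structure PDual (k : ℕ) where
  blocks : Set (Set (Pt k))
  disjoint : ∀ B ∈ blocks, ∀ C ∈ blocks, ∀ x, x ∈ B → x ∈ C → B = C
  left : ∀ B ∈ blocks, ∃ a, Sum.inl a ∈ B
  right : ∀ B ∈ blocks, ∃ b, Sum.inr b ∈ B

namespace PDual

variable {k : ℕ}

/-- The subset of which `α` is a partition. The other points are the one-element blocks of `α`
when `α` is extended to a partition of all points. -/
def support (α : PDual k) : Set (Pt k) := ⋃₀ α.blocks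

/-- The points of the diagram of a product: top, middle and bottom row. -/
abbrev Pt3 (k : ℕ) : Type := Fin k ⊕ (Fin k ⊕ Fin k)

/-- Places the left factor on the top and middle rows. -/
def upper : Pt k → Pt3 k := Sum.elim Sum.inl (fun b => Sum.inr (Sum.inl b))

/-- Places the right factor on the middle and bottom rows. -/
def lower : Pt k → Pt3 k := Sum.elim (fun a => Sum.inr (Sum.inl a)) (fun b => Sum.inr (Sum.inr b))

/-- Places the product on the top and bottom rows. -/
def outer : Pt k → Pt3 k := Sum.elim Sum.inl (fun b => Sum.inr (Sum.inr b))

/-- Two points of the diagram lie in the same block of one of the factors. -/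
def Step (α β : PDual k) (u v : Pt3 k) : Prop :=
  (∃ B ∈ α.blocks, ∃ x ∈ B, ∃ y ∈ B, upper x = u ∧ upper y = v) ∨
  (∃ B ∈ β.blocks, ∃ x ∈ B, ∃ y ∈ B, lower x = u ∧ lower y = v)

/-- Two points of the diagram lie in the same connected component. -/
def Conn (α β : PDual k) : Pt3 k → Pt3 k → Prop := Relation.EqvGen (Step α β)

/-- The point is a one-element block of (the extension of) one of the factors. -/
def Dead (α β : PDual k) (u : Pt3 k) : Prop :=
  (∃ x, x ∉ α.support ∧ upper x = u) ∨ (∃ x, x ∉ β.support ∧ lower x = u)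

/-- The component of the point contains no one-element block of the factors. -/
def Survives (α β : PDual k) (u : Pt3 k) : Prop := ∀ v, Conn α β u v → ¬ Dead α β v

theorem Survives.of_conn {α β : PDual k} {u v : Pt3 k} (h : Survives α β u)
    (huv : Conn α β u v) : Survives α β v :=
  fun w hw => h w (huv.trans _ _ _ hw)

theorem exists_mid_of_top {α β : PDual k} {a : Fin k} (h : Survives α β (Sum.inl a)) :
    ∃ b, Conn α β (Sum.inl a) (Sum.inr (Sum.inl b)) := by
  by_cases hs : Sum.inl a ∈ α.support
  · obtain ⟨B, hB, haB⟩ := hs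
    obtain ⟨b, hb⟩ := α.right B hB
    exact ⟨b, .rel _ _ (Or.inl ⟨B, hB, _, haB, _, hb, rfl, rfl⟩)⟩
  · exact (h _ (.refl _) (Or.inl ⟨_, hs, rfl⟩)).elim

theorem exists_top_of_mid {α β : PDual k} {b : Fin k} (h : Survives α β (Sum.inr (Sum.inl b))) :
    ∃ a, Conn α β (Sum.inl a) (Sum.inr (Sum.inl b)) := by
  by_cases hs : Sum.inr b ∈ α.support
  · obtain ⟨B, hB, hbB⟩ := hs
    obtain ⟨a, ha⟩ := α.left B hB
    exact ⟨a, .rel _ _ (Or.inl ⟨B, hB, _, ha, _, hbB, rfl, rfl⟩)⟩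
  · exact (h _ (.refl _) (Or.inl ⟨_, hs, rfl⟩)).elim

theorem exists_bot_of_mid {α β : PDual k} {b : Fin k} (h : Survives α β (Sum.inr (Sum.inl b))) :
    ∃ c, Conn α β (Sum.inr (Sum.inl b)) (Sum.inr (Sum.inr c)) := by
  by_cases hs : Sum.inl b ∈ β.support
  · obtain ⟨B, hB, hbB⟩ := hs
    obtain ⟨c, hc⟩ := β.right B hB
    exact ⟨c, .rel _ _ (Or.inr ⟨B, hB, _, hbB, _, hc, rfl, rfl⟩)⟩
  · exact (h _ (.refl _) (Or.inr ⟨_, hs, rfl⟩)).elim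

theorem exists_mid_of_bot {α β : PDual k} {c : Fin k} (h : Survives α β (Sum.inr (Sum.inr c))) :
    ∃ b, Conn α β (Sum.inr (Sum.inl b)) (Sum.inr (Sum.inr c)) := by
  by_cases hs : Sum.inr c ∈ β.support
  · obtain ⟨B, hB, hcB⟩ := hs
    obtain ⟨b, hb⟩ := β.left B hB
    exact ⟨b, .rel _ _ (Or.inr ⟨B, hB, _, hb, _, hcB, rfl, rfl⟩)⟩
  · exact (h _ (.refl _) (Or.inr ⟨_, hs, rfl⟩)).elim

/-- The product `αβ`: identify the primed points of `α` with the unprimed points of `β`. The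
blocks of the product are the traces on the top and bottom rows of those connected components that
contain no one-element block of the factors. -/
def mul (α β : PDual k) : PDual k where
  blocks := {C | ∃ x, Survives α β (outer x) ∧ C = {y | Conn α β (outer x) (outer y)}}
  disjoint := by
    rintro _ ⟨x, -, rfl⟩ _ ⟨y, -, rfl⟩ z hx hy
    have hxy : Conn α β (outer x) (outer y) := hx.trans _ _ _ (hy.symm _ _)
    ext w
    exact ⟨fun h => (hxy.symm _ _).trans _ _ _ h, fun h => hxy.trans _ _ _ h⟩
  left := by
    rintro _ ⟨x, hx, rfl⟩
    rcases x with a | c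
    · exact ⟨a, .refl _⟩
    · obtain ⟨b, hb⟩ := exists_mid_of_bot hx
      obtain ⟨a, ha⟩ := exists_top_of_mid (hx.of_conn (hb.symm _ _))
      exact ⟨a, (ha.trans _ _ _ hb).symm _ _⟩
  right := by
    rintro _ ⟨x, hx, rfl⟩
    rcases x with a | c
    · obtain ⟨b, hb⟩ := exists_mid_of_top hx
      obtain ⟨c, hc⟩ := exists_bot_of_mid (hx.of_conn hb)
      exact ⟨c, hb.trans _ _ _ hc⟩
    · exact ⟨c, .refl _⟩

/-- The identity: the partition into the blocks `{a, a'}`. -/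
def one : PDual k where
  blocks := {C | ∃ a, C = {Sum.inl a, Sum.inr a}}
  disjoint := by
    rintro _ ⟨a, rfl⟩ _ ⟨b, rfl⟩ x hx hy
    rcases hx with rfl | rfl <;> rcases hy with h | h <;> cases h <;> rfl
  left := by rintro _ ⟨a, rfl⟩; exact ⟨a, by simp⟩
  right := by rintro _ ⟨a, rfl⟩; exact ⟨a, by simp⟩

instance : Mul (PDual k) := ⟨mul⟩

instance : One (PDual k) := ⟨one⟩

/-- For index tuples `i` and `l` with a distinguished index `z`: the indices `i_a` and `l_b` agree
along each block of `α`, and are equal to `z` at the points outside the blocks. -/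
def Compat {X : Type*} (z : X) (α : PDual k) (i l : Fin k → X) : Prop :=
  (∀ B ∈ α.blocks, ∀ x ∈ B, ∀ y ∈ B, Sum.elim i l x = Sum.elim i l y) ∧
  (∀ x, x ∉ α.support → Sum.elim i l x = z)

theorem Compat.unique {X : Type*} {z : X} {α : PDual k} {i l m : Fin k → X}
    (hl : Compat z α i l) (hm : Compat z α i m) : l = m := by
  funext b
  by_cases hb : Sum.inr b ∈ α.support
  · obtain ⟨B, hB, hbB⟩ := hb
    obtain ⟨a, ha⟩ := α.left B hB
    exact (hl.1 B hB _ hbB _ ha).trans (hm.1 B hB _ ha _ hbB)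
  · exact (hl.2 _ hb).trans (hm.2 _ hb).symm

theorem compat_one {X : Type*} {z : X} {i l : Fin k → X} :
    Compat z (1 : PDual k) i l ↔ i = l := by
  constructor
  · intro h
    funext a
    exact h.1 {Sum.inl a, Sum.inr a} ⟨a, rfl⟩ (Sum.inl a) (by simp) (Sum.inr a) (by simp)
  · rintro rfl
    refine ⟨?_, fun x hx => ?_⟩
    · rintro _ ⟨a, rfl⟩ x hx y hy
      rcases hx with rfl | rfl <;> rcases hy with h | h <;> cases h <;> rfl
    · refine (hx ?_).elim
      rcases x with a | a
      · exact ⟨_, ⟨a, rfl⟩, by simp⟩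
      · exact ⟨_, ⟨a, rfl⟩, by simp⟩

theorem compat_mul {X : Type*} {z : X} {α β : PDual k} {i m : Fin k → X} :
    Compat z (α * β) i m ↔ ∃ l, Compat z α i l ∧ Compat z β l m := by
  classical
  constructor
  · intro h
    have dead : ∀ w, ¬ Survives α β (outer w) → Sum.elim i m w = z := by
      intro w hw
      apply h.2
      rintro ⟨_, ⟨v, hv, rfl⟩, hwv⟩
      exact hw (hv.of_conn hwv)
    have key : ∀ x y : Pt k, Conn α β (outer x) (outer y) → Sum.elim i m x = Sum.elim i m y := by
      intro x y hxy
      by_cases hx : Survives α β (outer x)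
      · exact h.1 _ ⟨x, hx, rfl⟩ x (.refl _) y hxy
      · rw [dead x hx, dead y fun hy => hx (hy.of_conn (hxy.symm _ _))]
    let g : Pt3 k → X := fun u =>
      if hu : Survives α β u ∧ ∃ x : Pt k, Conn α β u (outer x) then
        Sum.elim i m hu.2.choose else z
    have g_outer : ∀ x, g (outer x) = Sum.elim i m x := by
      intro x
      by_cases hx : Survives α β (outer x)
      · have hu : Survives α β (outer x) ∧ ∃ y : Pt k, Conn α β (outer x) (outer y) :=
          ⟨hx, x, .refl _⟩
        simp only [g, dif_pos hu]
        exact (key _ _ hu.2.choose_spec).symm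
      · simp only [g]
        rw [dif_neg (fun hu => hx hu.1), dead x hx]
    have g_conn : ∀ u v, Conn α β u v → g u = g v := by
      intro u v huv
      by_cases hu : Survives α β u ∧ ∃ x : Pt k, Conn α β u (outer x)
      · have hv : Survives α β v ∧ ∃ x : Pt k, Conn α β v (outer x) :=
          ⟨hu.1.of_conn huv, hu.2.choose, (huv.symm _ _).trans _ _ _ hu.2.choose_spec⟩
        simp only [g, dif_pos hu, dif_pos hv]
        exact key _ _ ((hu.2.choose_spec.symm _ _).trans _ _ _ (huv.trans _ _ _ hv.2.choose_spec))
      · have hv : ¬ (Survives α β v ∧ ∃ x : Pt k, Conn α β v (outer x)) := fun hv =>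
          hu ⟨hv.1.of_conn (huv.symm _ _), hv.2.choose, huv.trans _ _ _ hv.2.choose_spec⟩
        simp only [g, dif_neg hu, dif_neg hv]
    have g_dead : ∀ u, Dead α β u → g u = z := by
      intro u hu
      simp only [g]
      exact dif_neg fun h => h.1 u (.refl _) hu
    let l : Fin k → X := fun b => g (Sum.inr (Sum.inl b))
    have hup : ∀ x, Sum.elim i l x = g (upper x) := by
      rintro (a | b)
      · exact (g_outer (Sum.inl a)).symm
      · rfl
    have hlo : ∀ x, Sum.elim l m x = g (lower x) := by
      rintro (a | b)
      · rfl
      · exact (g_outer (Sum.inr b)).symm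
    refine ⟨l, ⟨fun B hB x hx y hy => ?_, fun x hx => ?_⟩,
      ⟨fun B hB x hx y hy => ?_, fun x hx => ?_⟩⟩
    · rw [hup, hup]
      exact g_conn _ _ (.rel _ _ (Or.inl ⟨B, hB, x, hx, y, hy, rfl, rfl⟩))
    · rw [hup]; exact g_dead _ (Or.inl ⟨x, hx, rfl⟩)
    · rw [hlo, hlo]
      exact g_conn _ _ (.rel _ _ (Or.inr ⟨B, hB, x, hx, y, hy, rfl, rfl⟩))
    · rw [hlo]; exact g_dead _ (Or.inr ⟨x, hx, rfl⟩)
  · rintro ⟨l, hα, hβ⟩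
    let g : Pt3 k → X := Sum.elim i (Sum.elim l m)
    have hup : ∀ x, Sum.elim i l x = g (upper x) := by rintro (a | b) <;> rfl
    have hlo : ∀ x, Sum.elim l m x = g (lower x) := by rintro (a | b) <;> rfl
    have hou : ∀ x, Sum.elim i m x = g (outer x) := by rintro (a | b) <;> rfl
    have g_conn : ∀ u v, Conn α β u v → g u = g v := by
      intro u v huv
      induction huv with
      | rel u v h =>
        rcases h with ⟨B, hB, x, hx, y, hy, rfl, rfl⟩ | ⟨B, hB, x, hx, y, hy, rfl, rfl⟩
        · rw [← hup, ← hup]; exact hα.1 B hB x hx y hy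
        · rw [← hlo, ← hlo]; exact hβ.1 B hB x hx y hy
      | refl => rfl
      | symm _ _ _ ih => exact ih.symm
      | trans _ _ _ _ _ ih₁ ih₂ => exact ih₁.trans ih₂
    have g_dead : ∀ u, Dead α β u → g u = z := by
      rintro u (⟨x, hx, rfl⟩ | ⟨x, hx, rfl⟩)
      · rw [← hup]; exact hα.2 x hx
      · rw [← hlo]; exact hβ.2 x hx
    constructor
    · rintro _ ⟨w, -, rfl⟩ x hx y hy
      rw [hou, hou]
      exact g_conn _ _ ((hx.symm _ _).trans _ _ _ hy)
    · intro x hx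
      have hs : ¬ Survives α β (outer x) := fun hs => hx ⟨_, ⟨x, hs, rfl⟩, .refl _⟩
      simp only [Survives, not_forall, not_not] at hs
      obtain ⟨v, hv, hd⟩ := hs
      rw [hou, g_conn _ _ hv, g_dead v hd]

theorem exists_block_subset {α β : PDual k}
    (h : ∀ i l : Fin k → Prop, Compat False α i l → Compat False β i l)
    {B : Set (Pt k)} (hB : B ∈ α.blocks) {x : Pt k} (hx : x ∈ B) :
    ∃ C ∈ β.blocks, x ∈ C ∧ C ⊆ B := by
  have hf : ∀ y, Sum.elim (fun a => Sum.inl a ∈ B) (fun b => Sum.inr b ∈ B) y = (y ∈ B) := by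
    rintro (a | b) <;> rfl
  have hc : Compat False β (fun a => Sum.inl a ∈ B) (fun b => Sum.inr b ∈ B) := by
    apply h
    constructor
    · intro C hC y hy w hw
      rw [hf, hf]
      apply propext
      constructor
      · intro hyB; rw [α.disjoint B hB C hC y hyB hy]; exact hw
      · intro hwB; rw [α.disjoint B hB C hC w hwB hw]; exact hy
    · intro y hy
      rw [hf]
      exact eq_false fun hyB => hy ⟨B, hB, hyB⟩
  by_cases hs : x ∈ β.support
  · obtain ⟨C, hC, hxC⟩ := hs
    refine ⟨C, hC, hxC, fun y hy => ?_⟩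
    have := hc.1 C hC x hxC y hy
    rw [hf, hf] at this
    exact this ▸ hx
  · have := hc.2 x hs
    rw [hf] at this
    exact (this ▸ hx : False).elim

theorem blocks_subset {α β : PDual k}
    (h : ∀ i l : Fin k → Prop, Compat False α i l ↔ Compat False β i l) :
    α.blocks ⊆ β.blocks := by
  intro B hB
  obtain ⟨a, ha⟩ := α.left B hB
  obtain ⟨C, hC, haC, hCB⟩ := exists_block_subset (fun i l => (h i l).1) hB ha
  obtain ⟨D, hD, haD, hDC⟩ := exists_block_subset (fun i l => (h i l).2) hC haC
  obtain rfl := α.disjoint B hB D hD _ ha haD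
  rwa [Set.Subset.antisymm hDC hCB]

theorem ext_compat {α β : PDual k}
    (h : ∀ i l : Fin k → Prop, Compat False α i l ↔ Compat False β i l) : α = β :=
  PDual.ext (Set.Subset.antisymm (blocks_subset h) (blocks_subset fun i l => (h i l).symm))

instance : Monoid (PDual k) where
  mul_assoc α β γ := by
    apply ext_compat
    intro i l
    simp only [compat_mul]
    constructor
    · rintro ⟨p, ⟨q, h₁, h₂⟩, h₃⟩; exact ⟨q, h₁, p, h₂, h₃⟩
    · rintro ⟨q, h₁, p, h₂, h₃⟩; exact ⟨p, ⟨q, h₁, h₂⟩, h₃⟩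
  one_mul α := by apply ext_compat; intro i l; simp [compat_mul, compat_one]
  mul_one α := by apply ext_compat; intro i l; simp [compat_mul, compat_one]

end PDual

/-! ### The action of the partial dual symmetric inverse semigroup on `U^{⊗k}` -/

/-- The basis `e_0, e_1, …, e_n` of `U`, where `e_0` (indexed by `none`) spans the trivial summand
and the other vectors (indexed by `some`) form the standard basis of `V`. -/
noncomputable def basisU (n : ℕ) : Module.Basis (Option (Fin n)) ℂ (U n) :=
  ((Pi.basisFun ℂ (Fin n)).prod (Module.Basis.singleton PUnit.{1} ℂ)).reindex
    (Equiv.optionEquivSumPUnit (Fin n)).symm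

theorem basisU_none (n : ℕ) : basisU n none = (0, 1) := by
  simp [basisU]

theorem basisU_some (n : ℕ) (j : Fin n) : basisU n (some j) = (Pi.single j 1, 0) := by
  simp [basisU]

/-- The basis `v_i = e_{i_1} ⊗ ⋯ ⊗ e_{i_k}` of `U^{⊗k}`. -/
noncomputable def basisT (n k : ℕ) : Module.Basis (Fin k → Option (Fin n)) ℂ (TensorU n k) :=
  Basis.piTensorProduct fun _ => basisU n

theorem basisT_apply (n k : ℕ) (i : Fin k → Option (Fin n)) :
    basisT n k i = ⨂ₜ[ℂ] a, basisU n (i a) :=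
  Basis.piTensorProduct_apply _ i

open Classical in
/-- The operator of `α`: it sends `v_i` to the sum of all `v_l` with `l` compatible with `i`. -/
noncomputable def rightOp (n : ℕ) {k : ℕ} (α : PDual k) : Module.End ℂ (TensorU n k) :=
  (basisT n k).constr ℂ fun i =>
    ∑ l : Fin k → Option (Fin n) with PDual.Compat none α i l, basisT n k l

theorem rightOp_of_compat {n k : ℕ} {α : PDual k} {i l : Fin k → Option (Fin n)}
    (h : PDual.Compat none α i l) : rightOp n α (basisT n k i) = basisT n k l := by
  classical
  rw [rightOp, Module.Basis.constr_basis]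
  have : (Finset.univ.filter fun l => PDual.Compat none α i l) = {l} := by
    ext m
    simp only [Finset.mem_filter, Finset.mem_univ, true_and, Finset.mem_singleton]
    exact ⟨fun hm => hm.unique h, fun hm => hm ▸ h⟩
  convert Finset.sum_singleton (fun l => basisT n k l) l using 2

theorem rightOp_of_not {n k : ℕ} {α : PDual k} {i : Fin k → Option (Fin n)}
    (h : ∀ l, ¬ PDual.Compat none α i l) : rightOp n α (basisT n k i) = 0 := by
  classical
  rw [rightOp, Module.Basis.constr_basis]
  apply Finset.sum_eq_zero
  intro l hl
  exact (h l (Finset.mem_filter.1 hl).2).elim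

theorem rightOp_one (n k : ℕ) : rightOp n (1 : PDual k) = 1 := by
  apply (basisT n k).ext
  intro i
  rw [rightOp_of_compat (PDual.compat_one.2 rfl), Module.End.one_apply]

theorem rightOp_mul (n : ℕ) {k : ℕ} (α β : PDual k) :
    rightOp n (α * β) = rightOp n β * rightOp n α := by
  apply (basisT n k).ext
  intro i
  rw [Module.End.mul_apply]
  by_cases h : ∃ l, PDual.Compat none α i l
  · obtain ⟨l, hl⟩ := h
    rw [rightOp_of_compat hl]
    by_cases h' : ∃ m, PDual.Compat none β l m
    · obtain ⟨m, hm⟩ := h'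
      rw [rightOp_of_compat hm, rightOp_of_compat (PDual.compat_mul.2 ⟨l, hl, hm⟩)]
    · rw [rightOp_of_not (not_exists.1 h'), rightOp_of_not]
      intro m hm
      obtain ⟨l', hl', hm'⟩ := PDual.compat_mul.1 hm
      exact h' ⟨m, hl.unique hl' ▸ hm'⟩
  · rw [rightOp_of_not (not_exists.1 h), map_zero, rightOp_of_not]
    intro m hm
    obtain ⟨l', hl', -⟩ := PDual.compat_mul.1 hm
    exact h ⟨l', hl'⟩

/-- The action is a right action: a homomorphism to the opposite of the endomorphism algebra. -/
noncomputable def rightRep (n k : ℕ) : PDual k →* (Module.End ℂ (TensorU n k))ᵐᵒᵖ where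
  toFun α := MulOpposite.op (rightOp n α)
  map_one' := congrArg MulOpposite.op (rightOp_one n k)
  map_mul' α β := congrArg MulOpposite.op (rightOp_mul n α β)

/-- The representation of the semigroup algebra of the symmetric inverse semigroup. -/
noncomputable def leftAlg (n k : ℕ) :
    MonoidAlgebra ℂ (SymInv n) →ₐ[ℂ] Module.End ℂ (TensorU n k) :=
  (leftRep n k).asAlgebraHom

/-- The (right) representation of the semigroup algebra of the partial dual symmetric inverse
semigroup. -/
noncomputable def rightAlg (n k : ℕ) :
    MonoidAlgebra ℂ (PDual k) →ₐ[ℂ] (Module.End ℂ (TensorU n k))ᵐᵒᵖ :=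
  MonoidAlgebra.lift ℂ (Module.End ℂ (TensorU n k))ᵐᵒᵖ (PDual k) (rightRep n k)

end RookDuality

namespace RookDuality

/-! ### Möbius inversion for spans -/

section Moebius

/-! In the basis `basisT`, every element of either semigroup acts by the 0-1 matrix of a partial
injection on index tuples. A `σ` relates tuples entry by entry (`LRel`); an `α` relates tuples that
follow its blocks (`PDual.Compat`). Applying `σ` preserves both the zeros and the equalities between
entries, which is all that compatibility with `α` sees; hence the actions commute.

Each family is indexed by a finite poset, and every pair of tuples related by some index has a least
such index: the partial injection defined exactly on the nonzero entries, respectively the partition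
into nonzero level sets. So the matrix of `a` is the sum over `c ≤ a` of the indicator matrices of
the pairs with least index `c`. This triangular change of generators preserves the span and linear
independence, and the indicators have disjoint supports. Consequently a matrix lies in the span iff
it vanishes on unrelated pairs and depends only on the least index (`mem_span_relMatrix` gives the
direction needed), and the family is independent iff each index is least for some pair
(`linearIndependent_relMatrix_iff`).

For the double centralizer, a matrix commuting with one family satisfies this criterion for the
other: idempotents of the first family fixing a given tuple control the support, and a suitable
element carrying one pair to another gives equality of entries. For the semigroup algebras, being
least for some pair requires enough positions to list `n` values on the left, and enough nonzero
values to label `k` blocks on the right. -/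

open Classical in
theorem span_range_sum_le {P M : Type*} [Fintype P] [PartialOrder P] [AddCommGroup M]
    [Module ℂ M] (E : P → M) :
    Submodule.span ℂ (Set.range fun a => ∑ c with c ≤ a, E c) =
      Submodule.span ℂ (Set.range E) := by
  apply le_antisymm
  · rw [Submodule.span_le]
    rintro _ ⟨a, rfl⟩
    exact Submodule.sum_mem _ fun c _ => Submodule.subset_span ⟨c, rfl⟩
  · rw [Submodule.span_le]
    rintro _ ⟨a, rfl⟩
    induction a using WellFoundedLT.induction with
    | ind a ih =>
      -- The change of generators is unitriangular, so `E a` is recovered from the sum up to `a` and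
      -- the terms strictly below, already in the span by induction.
      have h : E a = (∑ c with c ≤ a, E c) - ∑ c with c < a, E c := by
        have : (Finset.univ.filter fun c => c ≤ a) =
            insert a (Finset.univ.filter fun c => c < a) := by
          ext c; simp [le_iff_eq_or_lt]
        rw [this, Finset.sum_insert (by simp)]
        abel
      rw [h]
      exact Submodule.sub_mem _ (Submodule.subset_span ⟨a, rfl⟩)
        (Submodule.sum_mem _ fun c hc => ih c (Finset.mem_filter.1 hc).2)

-- For a finite family, independence depends only on the number of members and the dimension of the
-- span, and both families agree in these.
open Classical in
theorem linearIndependent_sum_le {P M : Type*} [Fintype P] [PartialOrder P] [AddCommGroup M]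
    [Module ℂ M] (E : P → M) :
    LinearIndependent ℂ (fun a => ∑ c with c ≤ a, E c) ↔ LinearIndependent ℂ E := by
  rw [linearIndependent_iff_card_eq_finrank_span, linearIndependent_iff_card_eq_finrank_span,
    Set.finrank, Set.finrank, span_range_sum_le]

end Moebius

/-! ### Matrices of relations -/

open Classical in
/-- The matrix with the `(l, i)` entry equal to `1` if `r i l`, and `0` otherwise. -/
noncomputable def relMatrix {I : Type*} (r : I → I → Prop) : Matrix I I ℂ :=
  Matrix.of fun l i => if r i l then 1 else 0

section RelMatrix

variable {I : Type*}

open Classical in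
theorem relMatrix_apply (r : I → I → Prop) (l i : I) :
    relMatrix r l i = if r i l then 1 else 0 := rfl

theorem relMatrix_injective : Function.Injective (relMatrix (I := I)) := by
  classical
  intro r s h
  funext i l
  have := congrFun (congrFun h l) i
  rw [relMatrix_apply, relMatrix_apply] at this
  by_cases hr : r i l <;> by_cases hs : s i l <;> simp_all

/-- A relation is a partial injection. -/
structure IsPartialInj (r : I → I → Prop) : Prop where
  right_unique : ∀ {i l m}, r i l → r i m → l = m
  left_unique : ∀ {i j l}, r i l → r j l → i = j

variable [Fintype I]

theorem relMatrix_mul_of_rel {r : I → I → Prop} (hr : IsPartialInj r) (A : Matrix I I ℂ)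
    {l l' : I} (h : r l l') (i : I) : (relMatrix r * A) l' i = A l i := by
  classical
  rw [Matrix.mul_apply, Finset.sum_eq_single l]
  · simp [relMatrix_apply, h]
  · intro m _ hm
    rw [relMatrix_apply, if_neg fun hm' => hm (hr.left_unique hm' h), zero_mul]
  · simp

theorem relMatrix_mul_of_not {r : I → I → Prop} (A : Matrix I I ℂ)
    {l' : I} (h : ∀ l, ¬ r l l') (i : I) : (relMatrix r * A) l' i = 0 := by
  rw [Matrix.mul_apply]
  exact Finset.sum_eq_zero fun m _ => by rw [relMatrix_apply, if_neg (h m), zero_mul]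

theorem mul_relMatrix_of_rel {r : I → I → Prop} (hr : IsPartialInj r) (A : Matrix I I ℂ)
    {i i' : I} (h : r i i') (l : I) : (A * relMatrix r) l i = A l i' := by
  classical
  rw [Matrix.mul_apply, Finset.sum_eq_single i']
  · simp [relMatrix_apply, h]
  · intro m _ hm
    rw [relMatrix_apply, if_neg fun hm' => hm (hr.right_unique hm' h), mul_zero]
  · simp

theorem mul_relMatrix_of_not {r : I → I → Prop} (A : Matrix I I ℂ)
    {i : I} (h : ∀ i', ¬ r i i') (l : I) : (A * relMatrix r) l i = 0 := by
  rw [Matrix.mul_apply]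
  exact Finset.sum_eq_zero fun m _ => by rw [relMatrix_apply, if_neg (h m), mul_zero]

/-- Both sides are the `(l', i)` entry of the common product: by injectivity only one term survives
in each sum. -/
theorem apply_eq_of_commute {r : I → I → Prop} (hr : IsPartialInj r) {A : Matrix I I ℂ}
    (hA : relMatrix r * A = A * relMatrix r) {i i' l l' : I} (hi : r i i') (hl : r l l') :
    A l i = A l' i' := by
  rw [← relMatrix_mul_of_rel hr A hl, hA, mul_relMatrix_of_rel hr A hi]

/-- Without a preimage of `l'`, row `l'` of `relMatrix r * A` would vanish. With `i' = i` this
restricts the support of `A` in the column of a tuple fixed by `r`; the next lemma does the same for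
rows. -/
theorem exists_rel_to_of_commute {r : I → I → Prop} (hr : IsPartialInj r) {A : Matrix I I ℂ}
    (hA : relMatrix r * A = A * relMatrix r) {i i' l' : I} (hi : r i i') (h0 : A l' i' ≠ 0) :
    ∃ l, r l l' := by
  by_contra! h
  apply h0
  rw [← mul_relMatrix_of_rel hr A hi, ← hA, relMatrix_mul_of_not A h]

theorem exists_rel_from_of_commute {r : I → I → Prop} (hr : IsPartialInj r) {A : Matrix I I ℂ}
    (hA : relMatrix r * A = A * relMatrix r) {i l l' : I} (hl : r l l') (h0 : A l i ≠ 0) :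
    ∃ i', r i i' := by
  by_contra! h
  apply h0
  rw [← relMatrix_mul_of_rel hr A hl, hA, mul_relMatrix_of_not A h]

theorem relMatrix_commute {r s : I → I → Prop} (hr : IsPartialInj r) (hs : IsPartialInj s)
    (h : ∀ i l, (∃ m, r i m ∧ s m l) ↔ ∃ m, s i m ∧ r m l) :
    Commute (relMatrix r) (relMatrix s) := by
  classical
  -- Intermediate points are unique, so a matrix product is the 0-1 matrix of the composite
  -- relation, with no multiplicities.
  have key : ∀ {r s : I → I → Prop}, IsPartialInj s →
      relMatrix r * relMatrix s = relMatrix fun i l => ∃ m, s i m ∧ r m l := by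
    intro r s hs
    ext l i
    by_cases hi : ∃ m, s i m
    · obtain ⟨m, hm⟩ := hi
      rw [mul_relMatrix_of_rel hs _ hm, relMatrix_apply, relMatrix_apply]
      congr 1
      exact propext ⟨fun h => ⟨m, hm, h⟩, fun ⟨m', h, h'⟩ => hs.right_unique h hm ▸ h'⟩
    · rw [mul_relMatrix_of_not _ (not_exists.1 hi), relMatrix_apply, if_neg]
      exact fun ⟨m, hm, _⟩ => hi ⟨m, hm⟩
  rw [commute_iff_eq, key hs, key hr]
  congr 1
  funext i l
  exact propext (h i l).symm

end RelMatrix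

/-! ### Families of relations indexed by a finite poset -/

section Poset

variable {I P : Type*} [PartialOrder P]

/-- The pair `(i, l)` is related exactly by the indices above `c`. -/
def IsLeastRel (C : P → I → I → Prop) (c : P) (i l : I) : Prop := ∀ b, C b i l ↔ c ≤ b

theorem IsLeastRel.unique {C : P → I → I → Prop} {c d : P} {i l : I}
    (hc : IsLeastRel C c i l) (hd : IsLeastRel C d i l) : c = d :=
  le_antisymm ((hc d).1 ((hd d).2 le_rfl)) ((hd c).1 ((hc c).2 le_rfl))

-- A related pair has exactly one least index `c`, and `a` relates it iff `c ≤ a`; so exactly one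
-- summand contributes there.
open Classical in
theorem relMatrix_eq_sum [Fintype P] {C : P → I → I → Prop}
    (hC : ∀ a i l, C a i l → ∃ c, IsLeastRel C c i l) (a : P) :
    relMatrix (C a) = ∑ c with c ≤ a, relMatrix (IsLeastRel C c) := by
  ext l i
  rw [Matrix.sum_apply, relMatrix_apply]
  split_ifs with h
  · obtain ⟨c, hc⟩ := hC a i l h
    rw [Finset.sum_eq_single c]
    · rw [relMatrix_apply, if_pos hc]
    · intro d _ hd
      rw [relMatrix_apply, if_neg fun h' => hd (h'.unique hc)]
    · intro h'
      exact (h' (by simpa using (hc a).1 h)).elim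
  · symm
    apply Finset.sum_eq_zero
    intro c hc
    rw [relMatrix_apply, if_neg fun h' => h ((h' a).2 (Finset.mem_filter.1 hc).2)]

/-- The indicators of the least-index classes span the same space, and `A` is constant on each class
and zero outside all of them. -/
theorem mem_span_relMatrix [Finite P] {C : P → I → I → Prop}
    (hC : ∀ a i l, C a i l → ∃ c, IsLeastRel C c i l) {A : Matrix I I ℂ}
    (h0 : ∀ i l, A l i ≠ 0 → ∃ a, C a i l)
    (h1 : ∀ i l i' l' c, IsLeastRel C c i l → IsLeastRel C c i' l' → A l i = A l' i') :
    A ∈ Submodule.span ℂ (Set.range fun a => relMatrix (C a)) := by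
  classical
  have := Fintype.ofFinite P
  simp only [relMatrix_eq_sum hC]
  rw [span_range_sum_le]
  -- The common value of `A` on the class of `c`; the default `0` for an empty class is immaterial,
  -- since its indicator is zero.
  let f : P → ℂ := fun c => if h : ∃ p : I × I, IsLeastRel C c p.1 p.2 then
    A h.choose.2 h.choose.1 else 0
  have hA : A = ∑ c, f c • relMatrix (IsLeastRel C c) := by
    ext l i
    rw [Matrix.sum_apply]
    by_cases h : ∃ c, IsLeastRel C c i l
    · obtain ⟨c, hc⟩ := h
      rw [Finset.sum_eq_single c]
      · have hp : ∃ p : I × I, IsLeastRel C c p.1 p.2 := ⟨(i, l), hc⟩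
        rw [Matrix.smul_apply, relMatrix_apply, if_pos hc]
        simp only [f, dif_pos hp, smul_eq_mul, mul_one]
        exact h1 _ _ _ _ c hc hp.choose_spec
      · intro d _ hd
        rw [Matrix.smul_apply, relMatrix_apply, if_neg fun h' => hd (h'.unique hc), smul_zero]
      · simp
    · rw [Finset.sum_eq_zero]
      · by_contra hne
        obtain ⟨a, ha⟩ := h0 i l hne
        exact h (hC a i l ha)
      · intro c _
        rw [Matrix.smul_apply, relMatrix_apply, if_neg fun h' => h ⟨c, h'⟩, smul_zero]
  rw [hA]
  exact Submodule.sum_mem _ fun c _ => Submodule.smul_mem _ _ (Submodule.subset_span ⟨c, rfl⟩)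

/-- Matrices with disjoint supports are independent iff none of them is zero, that is, iff no
least-index class is empty. -/
theorem linearIndependent_relMatrix_iff [Finite P] {C : P → I → I → Prop}
    (hC : ∀ a i l, C a i l → ∃ c, IsLeastRel C c i l) :
    LinearIndependent ℂ (fun a => relMatrix (C a)) ↔ ∀ c, ∃ i l, IsLeastRel C c i l := by
  classical
  have := Fintype.ofFinite P
  simp only [relMatrix_eq_sum hC]
  rw [linearIndependent_sum_le]
  constructor
  · intro h c
    by_contra! hc
    apply h.ne_zero c
    ext l i
    rw [relMatrix_apply, if_neg (hc i l), Matrix.zero_apply]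
  · intro h
    rw [Fintype.linearIndependent_iff]
    intro g hg c
    obtain ⟨i, l, hc⟩ := h c
    have := congrFun (congrFun hg l) i
    rw [Matrix.sum_apply, Finset.sum_eq_single c] at this
    · simpa [relMatrix_apply, hc] using this
    · intro d _ hd
      rw [Matrix.smul_apply, relMatrix_apply, if_neg fun h' => hd (h'.unique hc), smul_zero]
    · simp

end Poset

/-! ### The action of partial injections on index tuples -/

instance (n : ℕ) : PartialOrder (SymInv n) :=
  inferInstanceAs (PartialOrder (PEquiv (Fin n) (Fin n)))

instance (n : ℕ) : Finite (SymInv n) :=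
  Finite.of_injective (β := Fin n → Option (Fin n)) (fun σ => PEquiv.toFun σ)
    (DFunLike.coe_injective (F := PEquiv (Fin n) (Fin n)))

/-- The tuple `w'` is the image of the tuple `w` under `σ`, where `none` is sent to `none`. -/
def LRel {n : ℕ} {S : Type*} (σ : PEquiv (Fin n) (Fin n)) (w w' : S → Option (Fin n)) : Prop :=
  ∀ s, (w s = none ∧ w' s = none) ∨ ∃ x y, w s = some x ∧ w' s = some y ∧ y ∈ σ x

section LRel

variable {n : ℕ} {S : Type*} {σ τ : PEquiv (Fin n) (Fin n)} {w w' w'' : S → Option (Fin n)}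

theorem LRel.symm (h : LRel σ w w') : LRel σ.symm w' w := by
  intro s
  rcases h s with ⟨h, h'⟩ | ⟨x, y, hx, hy, hxy⟩
  · exact Or.inl ⟨h', h⟩
  · exact Or.inr ⟨y, x, hy, hx, σ.mem_iff_mem.2 hxy⟩

theorem LRel.right_unique (h : LRel σ w w') (h' : LRel σ w w'') : w' = w'' := by
  funext s
  rcases h s with ⟨h, h₁⟩ | ⟨x, y, hx, hy, hxy⟩ <;>
    rcases h' s with ⟨h', h₂⟩ | ⟨x', y', hx', hy', hxy'⟩ <;> simp_all

theorem LRel.left_unique (h : LRel σ w w'') (h' : LRel σ w' w'') : w = w' :=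
  h.symm.right_unique h'.symm

theorem isPartialInj_LRel (σ : PEquiv (Fin n) (Fin n)) :
    IsPartialInj (LRel (S := S) σ) :=
  ⟨fun h h' => h.right_unique h', fun h h' => h.left_unique h'⟩

theorem LRel.mono (hστ : σ ≤ τ) (h : LRel σ w w') : LRel τ w w' := by
  intro s
  rcases h s with h | ⟨x, y, hx, hy, hxy⟩
  · exact Or.inl h
  · exact Or.inr ⟨x, y, hx, hy, hστ x y hxy⟩

theorem LRel.eq_none_iff (h : LRel σ w w') (s : S) : w s = none ↔ w' s = none := by
  rcases h s with h | ⟨x, y, hx, hy, -⟩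
  · simp [h]
  · simp [hx, hy]

theorem LRel.eq_iff (h : LRel σ w w') (s t : S) : w s = w t ↔ w' s = w' t := by
  rcases h s with ⟨h₁, h₂⟩ | ⟨x, y, hx, hy, hxy⟩ <;>
    rcases h t with ⟨h₁', h₂'⟩ | ⟨x', y', hx', hy', hxy'⟩
  · simp_all
  · simp_all
  · simp_all
  · simp only [hx, hx', hy, hy', Option.some.injEq]
    constructor
    · rintro rfl; exact Option.mem_unique hxy hxy'
    · rintro rfl; exact σ.inj hxy hxy'

theorem lRel_sumElim {S' : Type*} {v v' : S' → Option (Fin n)} :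
    LRel σ (Sum.elim w v) (Sum.elim w' v') ↔ LRel σ w w' ∧ LRel σ v v' :=
  ⟨fun h => ⟨fun s => h (Sum.inl s), fun s => h (Sum.inr s)⟩,
    fun h s => s.rec (fun s => h.1 s) (fun s => h.2 s)⟩

theorem exists_lRel_of_forall (h : ∀ s x, w s = some x → ∃ y, y ∈ σ x) : ∃ w', LRel σ w w' := by
  refine ⟨fun s => (w s).bind σ, fun s => ?_⟩
  dsimp only
  rcases hs : w s with _ | x
  · exact Or.inl ⟨rfl, rfl⟩
  · obtain ⟨y, hy⟩ := h s x hs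
    exact Or.inr ⟨x, y, rfl, hy, hy⟩

/-- The domain of `σ` contains every nonzero entry of `w`, hence every nonzero entry of `v`. -/
theorem LRel.exists_image {S' : Type*} {v : S' → Option (Fin n)} (h : LRel σ w w')
    (hv : ∀ t, v t ≠ none → ∃ s, w s = v t) : ∃ v', LRel σ v v' := by
  refine exists_lRel_of_forall fun t x ht => ?_
  obtain ⟨s, hs⟩ := hv t (by simp [ht])
  rcases h s with ⟨h, -⟩ | ⟨x', y, hx, -, hxy⟩
  · simp_all
  · obtain rfl : x' = x := Option.some.inj (hx.symm.trans (hs.trans ht))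
    exact ⟨y, hxy⟩

/-- Two tuples with the same zeros and the same equalities between their entries are related by a
partial injection, defined exactly on the nonzero entries. -/
theorem exists_lRel (h0 : ∀ s, w s = none ↔ w' s = none)
    (h : ∀ s t, w s = w t ↔ w' s = w' t) :
    ∃ σ : PEquiv (Fin n) (Fin n), LRel σ w w' ∧
      ∀ x y, y ∈ σ x → ∃ s, w s = some x ∧ w' s = some y := by
  classical
  let f : (S → Option (Fin n)) → (S → Option (Fin n)) → Fin n → Option (Fin n) := fun w w' x =>
    if hx : ∃ y s, w s = some x ∧ w' s = some y then some hx.choose else none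
  -- Stated for arbitrary tuples because the inverse map is the same construction with the two
  -- tuples exchanged.
  have hf : ∀ w w' : S → Option (Fin n), (∀ s t, w s = w t ↔ w' s = w' t) → ∀ x y,
      y ∈ f w w' x ↔ ∃ s, w s = some x ∧ w' s = some y := by
    intro w w' h x y
    simp only [f, Option.mem_def]
    split_ifs with hx
    · obtain ⟨s, hs, hs'⟩ := hx.choose_spec
      simp only [Option.some.injEq]
      constructor
      · rintro rfl; exact ⟨s, hs, hs'⟩
      · rintro ⟨t, ht, ht'⟩
        have := (h s t).1 (hs.trans ht.symm)
        rw [hs', ht'] at this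
        exact Option.some.inj this
    · simp only [false_iff]
      exact fun ⟨s, hs⟩ => hx ⟨y, s, hs⟩
  refine ⟨⟨f w w', f w' w, fun x y => ?_⟩, fun s => ?_, fun x y hxy => (hf w w' h x y).1 hxy⟩
  · exact (hf w' w (fun s t => (h s t).symm) y x).trans
      ((exists_congr fun s => and_comm).trans (hf w w' h x y).symm)
  · rcases hs : w s with _ | x
    · exact Or.inl ⟨rfl, (h0 s).1 hs⟩
    · obtain ⟨y, hy⟩ := Option.ne_none_iff_exists'.1
        (fun h' => by simp [(h0 s).2 h'] at hs : w' s ≠ none)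
      exact Or.inr ⟨x, y, rfl, hy, (hf w w' h x y).2 ⟨s, hs, hy⟩⟩

/-- The least partial injection relating two tuples. -/
theorem LRel.exists_least (h : LRel σ w w') :
    ∃ τ : PEquiv (Fin n) (Fin n), LRel τ w w' ∧ (∀ ρ, LRel ρ w w' → τ ≤ ρ) ∧
      ∀ x y, y ∈ τ x → ∃ s, w s = some x ∧ w' s = some y := by
  obtain ⟨τ, hτ, hd⟩ := exists_lRel h.eq_none_iff h.eq_iff
  refine ⟨τ, hτ, fun ρ hρ => ?_, hd⟩
  rw [PEquiv.le_def]
  intro x y hxy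
  obtain ⟨s, hs, hs'⟩ := hd x y hxy
  rcases hρ s with ⟨h₁, -⟩ | ⟨x', y', hx', hy', h'⟩
  · simp [hs] at h₁
  · simp_all

theorem exists_isLeastRel_lRel (σ : SymInv n) (w w' : S → Option (Fin n)) (h : LRel σ w w') :
    ∃ τ : SymInv n, IsLeastRel (fun σ : SymInv n => LRel (S := S) σ) τ w w' := by
  obtain ⟨τ, hτ, hl, -⟩ := h.exists_least
  exact ⟨τ, fun ρ => ⟨hl ρ, fun h => hτ.mono h⟩⟩

end LRel

/-! ### Compatibility of index tuples with a partition -/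

namespace PDual

variable {k : ℕ} {X Y : Type*} {z : X} {z' : Y} {α β : PDual k}

/-- Two index tuples whose entries depend on those of compatible tuples are compatible. -/
theorem Compat.of_factor {i l : Fin k → X} {i' l' : Fin k → Y} (h : Compat z α i l)
    (h0 : ∀ x, Sum.elim i l x = z → Sum.elim i' l' x = z')
    (h1 : ∀ x y, Sum.elim i l x = Sum.elim i l y → Sum.elim i' l' x = Sum.elim i' l' y) :
    Compat z' α i' l' :=
  ⟨fun B hB x hx y hy => h1 x y (h.1 B hB x hx y hy), fun x hx => h0 x (h.2 x hx)⟩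

theorem Compat.left_unique {i j l : Fin k → X} (hi : Compat z α i l) (hj : Compat z α j l) :
    i = j := by
  funext a
  by_cases ha : Sum.inl a ∈ α.support
  · obtain ⟨B, hB, haB⟩ := ha
    obtain ⟨b, hb⟩ := α.right B hB
    exact (hi.1 B hB _ haB _ hb).trans (hj.1 B hB _ haB _ hb).symm
  · exact (hi.2 _ ha).trans (hj.2 _ ha).symm

theorem isPartialInj_compat (z : X) (α : PDual k) : IsPartialInj (Compat z α) :=
  ⟨fun h h' => h.unique h', fun h h' => h.left_unique h'⟩

theorem Compat.exists_left {i l : Fin k → X} (h : Compat z α i l) {b : Fin k} (hb : l b ≠ z) :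
    ∃ a, i a = l b := by
  have hs : Sum.inr b ∈ α.support := by_contra fun hs => hb (h.2 _ hs)
  obtain ⟨B, hB, hbB⟩ := hs
  obtain ⟨a, ha⟩ := α.left B hB
  exact ⟨a, h.1 B hB _ ha _ hbB⟩

theorem Compat.exists_right {i l : Fin k → X} (h : Compat z α i l) {a : Fin k} (ha : i a ≠ z) :
    ∃ b, l b = i a := by
  have hs : Sum.inl a ∈ α.support := by_contra fun hs => ha (h.2 _ hs)
  obtain ⟨B, hB, haB⟩ := hs
  obtain ⟨b, hb⟩ := α.right B hB
  exact ⟨b, h.1 B hB _ hb _ haB⟩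

/-- The order in which `α ≤ β` if every block of `α` is a union of blocks of `β`: all pairs of
tuples compatible with `α` are compatible with `β`. -/
instance : PartialOrder (PDual k) where
  le α β := ∀ i l : Fin k → Prop, Compat False α i l → Compat False β i l
  le_refl _ _ _ h := h
  le_trans _ _ _ h h' i l hi := h' i l (h i l hi)
  le_antisymm _ _ h h' := ext_compat fun i l => ⟨h i l, h' i l⟩

instance : Finite (PDual k) :=
  Finite.of_injective PDual.blocks fun _ _ => PDual.ext

theorem sumElim_eq (i l : Fin k → X) (c : X) (x : Pt k) :
    Sum.elim (fun a => i a = c) (fun b => l b = c) x = (Sum.elim i l x = c) := by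
  rcases x with a | b <;> rfl

/-- The order only tests 0-1 tuples; general ones are recovered from the indicators of their level
sets at the values other than `z`. -/
theorem Compat.of_le {i l : Fin k → X} (hαβ : α ≤ β) (h : Compat z α i l) : Compat z β i l := by
  have key : ∀ c ≠ z, Compat False β (fun a => i a = c) (fun b => l b = c) := by
    intro c hc
    apply hαβ
    refine h.of_factor (fun x hx => ?_) fun x y hxy => ?_
    · rw [sumElim_eq, hx]; exact eq_false hc.symm
    · rw [sumElim_eq, sumElim_eq, hxy]
  constructor
  · intro B hB x hx y hy
    by_cases hz : Sum.elim i l x = z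
    -- The value `z` has no admissible indicator, so the level set of the other point `y` is used.
    · by_contra hne
      have := (key _ (fun h' => hne (hz.trans h'.symm) : Sum.elim i l y ≠ z)).1 B hB y hy x hx
      rw [sumElim_eq, sumElim_eq] at this
      exact hne (this.mp rfl)
    · have := (key _ hz).1 B hB x hx y hy
      rw [sumElim_eq, sumElim_eq] at this
      exact (this.mp rfl).symm
  · intro x hx
    by_contra hz
    have := (key _ hz).2 x hx
    rw [sumElim_eq] at this
    exact this.mp rfl

/-- The partition into the level sets of a pair of tuples for values other than `z`, where only
the values that occur in both tuples are taken into account. -/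
def levels (z : X) (i l : Fin k → X) : PDual k where
  blocks := {C | ∃ c ≠ z, (∃ a, i a = c) ∧ (∃ b, l b = c) ∧ C = {x | Sum.elim i l x = c}}
  disjoint := by
    rintro _ ⟨c, -, -, -, rfl⟩ _ ⟨d, -, -, -, rfl⟩ x hx hy
    obtain rfl : c = d := hx.symm.trans hy
    rfl
  left := by rintro _ ⟨c, -, ⟨a, ha⟩, -, rfl⟩; exact ⟨a, ha⟩
  right := by rintro _ ⟨c, -, -, ⟨b, hb⟩, rfl⟩; exact ⟨b, hb⟩

/-- When every value other than `z` occurs on both sides, no level set of such a value is discarded,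
so only entries `z` lie outside the blocks. -/
theorem compat_levels {i l : Fin k → X} (hl : ∀ a, i a ≠ z → ∃ b, l b = i a)
    (hr : ∀ b, l b ≠ z → ∃ a, i a = l b) : Compat z (levels z i l) i l := by
  constructor
  · rintro _ ⟨c, -, -, -, rfl⟩ x hx y hy
    exact Eq.trans hx (Eq.symm hy)
  · intro x hx
    by_contra hz
    apply hx
    refine ⟨_, ⟨Sum.elim i l x, hz, ?_, ?_, rfl⟩, rfl⟩
    · rcases x with a | b
      · exact ⟨a, rfl⟩
      · exact hr b hz
    · rcases x with a | b
      · exact hl a hz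
      · exact ⟨b, rfl⟩

theorem compat_levels_self (z : X) (i : Fin k → X) : Compat z (levels z i i) i i :=
  compat_levels (fun a _ => ⟨a, rfl⟩) fun a _ => ⟨a, rfl⟩

theorem Compat.compat_levels {i l : Fin k → X} (h : Compat z α i l) :
    Compat z (levels z i l) i l :=
  PDual.compat_levels (fun _ ha => h.exists_right ha) fun _ hb => h.exists_left hb

/-- The entries of a pair of tuples compatible with `levels z i l` depend on those of `i`, `l`. -/
theorem Compat.factor_levels {i l : Fin k → X} {i' l' : Fin k → Y}
    (h : Compat z (levels z i l) i l) (h' : Compat z' (levels z i l) i' l') :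
    (∀ x, Sum.elim i l x = z → Sum.elim i' l' x = z') ∧
    (∀ x y, Sum.elim i l x = Sum.elim i l y → Sum.elim i' l' x = Sum.elim i' l' y) := by
  have h0 : ∀ x, Sum.elim i l x = z → Sum.elim i' l' x = z' := by
    intro x hx
    apply h'.2
    rintro ⟨_, ⟨c, hc, -, -, rfl⟩, hxc⟩
    exact hc (Eq.trans (Eq.symm hxc) hx)
  refine ⟨h0, fun x y hxy => ?_⟩
  by_cases hz : Sum.elim i l x = z
  · rw [h0 x hz, h0 y (hxy ▸ hz)]
  · have hs : x ∈ (levels z i l).support := by_contra fun hs => hz (h.2 _ hs)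
    obtain ⟨_, ⟨c, hc, ha, hb, rfl⟩, hxc⟩ := hs
    exact h'.1 _ ⟨c, hc, ha, hb, rfl⟩ x hxc y (Eq.trans (Eq.symm hxy) hxc)

theorem Compat.levels_le {i l : Fin k → X} (h : Compat z α i l) : levels z i l ≤ α := by
  intro i' l' h'
  obtain ⟨h0, h1⟩ := h.compat_levels.factor_levels h'
  exact h.of_factor h0 h1

/-- Tuples compatible with the level-set partition factor through the values of `i` and `l`, so they
satisfy every constraint that `i` and `l` satisfy. -/
theorem Compat.isLeastRel_levels {i l : Fin k → X} (h : Compat z α i l) :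
    IsLeastRel (Compat z) (levels z i l) i l :=
  fun _ => ⟨fun h' => h'.levels_le, fun h' => h.compat_levels.of_le h'⟩

end PDual

/-! ### The operators in the basis `basisT` -/

section Operators

variable {n k : ℕ}

theorem linearIndependent_algEquiv_comp_iff {ι A B : Type*} [Semiring A] [Semiring B] [Algebra ℂ A]
    [Algebra ℂ B] (e : A ≃ₐ[ℂ] B) (f : ι → A) :
    LinearIndependent ℂ (fun a => e (f a)) ↔ LinearIndependent ℂ f :=
  LinearMap.linearIndependent_iff_of_injOn e.toLinearMap e.injective.injOn

theorem toMatrix_rightOp (α : PDual k) :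
    LinearMap.toMatrixAlgEquiv (basisT n k) (rightOp n α) =
      relMatrix (PDual.Compat none α) := by
  classical
  ext l i
  rw [LinearMap.toMatrixAlgEquiv_apply, relMatrix_apply]
  by_cases h : ∃ m, PDual.Compat none α i m
  · obtain ⟨m, hm⟩ := h
    rw [rightOp_of_compat hm, Module.Basis.repr_self, Finsupp.single_apply]
    congr 1
    exact propext ⟨fun h => h ▸ hm, fun h => hm.unique h⟩
  · rw [rightOp_of_not (not_exists.1 h), if_neg fun h' => h ⟨l, h'⟩, map_zero]
    rfl

theorem natRep_single_of_mem {σ : SymInv n} {x y : Fin n}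
    (h : y ∈ (show PEquiv (Fin n) (Fin n) from σ) x) :
    natRep n σ (Pi.single x 1) = Pi.single y 1 := by
  show (rookMatrix σ).mulVecLin (Pi.single x 1) = _
  ext j
  rw [Matrix.mulVecLin_apply, Matrix.mulVec_single_one, Matrix.col_apply, rookMatrix,
    Matrix.transpose_apply, PEquiv.toMatrix_apply, Pi.single_apply]
  congr 1
  exact propext ⟨fun hj => Option.mem_unique hj h, fun hj => hj ▸ h⟩

theorem natRep_single_of_not {σ : SymInv n} {x : Fin n}
    (h : ∀ y, y ∉ (show PEquiv (Fin n) (Fin n) from σ) x) :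
    natRep n σ (Pi.single x 1) = 0 := by
  show (rookMatrix σ).mulVecLin (Pi.single x 1) = _
  ext j
  rw [Matrix.mulVecLin_apply, Matrix.mulVec_single_one, Matrix.col_apply, rookMatrix,
    Matrix.transpose_apply, PEquiv.toMatrix_apply, if_neg (h j)]
  rfl

theorem repU_apply (σ : SymInv n) (v : Fin n → ℂ) (c : ℂ) :
    repU n σ (v, c) = (natRep n σ v, c) := rfl

theorem leftRep_basisT (σ : SymInv n) (i : Fin k → Option (Fin n)) :
    leftRep n k σ (basisT n k i) = ⨂ₜ[ℂ] a, repU n σ (basisU n (i a)) := by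
  rw [basisT_apply]
  exact PiTensorProduct.map_tprod _ _

theorem leftRep_of_lRel {σ : SymInv n} {i j : Fin k → Option (Fin n)} (h : LRel σ i j) :
    leftRep n k σ (basisT n k i) = basisT n k j := by
  rw [leftRep_basisT, basisT_apply]
  congr 1
  funext a
  rcases h a with ⟨hi, hj⟩ | ⟨x, y, hi, hj, hxy⟩
  · rw [hi, hj, basisU_none, repU_apply, map_zero]
  · rw [hi, hj, basisU_some, basisU_some, repU_apply, natRep_single_of_mem hxy]

theorem leftRep_of_not {σ : SymInv n} {i : Fin k → Option (Fin n)} (h : ∀ j, ¬ LRel σ i j) :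
    leftRep n k σ (basisT n k i) = 0 := by
  rw [leftRep_basisT]
  -- Some entry falls outside the domain of `σ`; its tensor factor is killed, and with it the whole
  -- tensor.
  have : ∃ a x, i a = some x ∧ ∀ y, y ∉ (show PEquiv (Fin n) (Fin n) from σ) x := by
    by_contra! hc
    obtain ⟨j, hj⟩ := exists_lRel_of_forall hc
    exact h j hj
  obtain ⟨a, x, hi, hx⟩ := this
  apply MultilinearMap.map_coord_zero _ a
  rw [hi, basisU_some, repU_apply, natRep_single_of_not hx]
  rfl

theorem toMatrix_leftRep (σ : SymInv n) :
    LinearMap.toMatrixAlgEquiv (basisT n k) (leftRep n k σ) = relMatrix (LRel σ) := by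
  classical
  ext l i
  rw [LinearMap.toMatrixAlgEquiv_apply, relMatrix_apply]
  by_cases h : ∃ m : Fin k → Option (Fin n), LRel σ i m
  · obtain ⟨m, hm⟩ := h
    rw [leftRep_of_lRel hm, Module.Basis.repr_self, Finsupp.single_apply]
    congr 1
    exact propext ⟨fun h => h ▸ hm, fun h => hm.right_unique h⟩
  · rw [leftRep_of_not (not_exists.1 h), if_neg fun h' => h ⟨l, h'⟩, map_zero]
    rfl

theorem leftAlg_eq (x : MonoidAlgebra ℂ (SymInv n)) :
    leftAlg n k x = Finsupp.linearCombination ℂ (fun σ => leftRep n k σ) x.coeff := by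
  rw [leftAlg, Representation.asAlgebraHom_def, MonoidAlgebra.lift_apply]
  rfl

theorem unop_rightAlg_eq (x : MonoidAlgebra ℂ (PDual k)) :
    (rightAlg n k x).unop = Finsupp.linearCombination ℂ (fun α => rightOp n α) x.coeff := by
  rw [rightAlg, MonoidAlgebra.lift_apply, Finsupp.sum]
  exact map_sum (MulOpposite.opLinearEquiv ℂ).symm _ _

theorem leftAlg_injective_iff : Function.Injective (leftAlg n k) ↔
    LinearIndependent ℂ fun σ : SymInv n => relMatrix (LRel (S := Fin k) σ) := by
  simp only [← toMatrix_leftRep]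
  rw [linearIndependent_algEquiv_comp_iff, LinearIndependent]
  have : ⇑(leftAlg n k) = ⇑(Finsupp.linearCombination ℂ fun σ => leftRep n k σ) ∘
      MonoidAlgebra.coeffEquiv := funext leftAlg_eq
  rw [this, EquivLike.injective_comp]

theorem rightAlg_injective_iff : Function.Injective (rightAlg n k) ↔
    LinearIndependent ℂ fun α : PDual k =>
      relMatrix (PDual.Compat (none : Option (Fin n)) α) := by
  simp only [← toMatrix_rightOp]
  rw [linearIndependent_algEquiv_comp_iff, LinearIndependent,
    ← MulOpposite.unop_injective.of_comp_iff]
  have : MulOpposite.unop ∘ ⇑(rightAlg n k) =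
      ⇑(Finsupp.linearCombination ℂ fun α => rightOp n α) ∘ MonoidAlgebra.coeffEquiv :=
    funext unop_rightAlg_eq
  rw [this, EquivLike.injective_comp]

theorem range_leftAlg : (Set.range fun x : MonoidAlgebra ℂ (SymInv n) => leftAlg n k x) =
    Submodule.span ℂ (Set.range fun σ => leftRep n k σ) := by
  rw [← Finsupp.range_linearCombination, LinearMap.coe_range]
  have : (fun x : MonoidAlgebra ℂ (SymInv n) => leftAlg n k x) =
      ⇑(Finsupp.linearCombination ℂ fun σ => leftRep n k σ) ∘
      MonoidAlgebra.coeffEquiv := funext leftAlg_eq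
  rw [this, EquivLike.range_comp]

theorem range_rightAlg :
    (Set.range fun x : MonoidAlgebra ℂ (PDual k) => (rightAlg n k x).unop) =
      Submodule.span ℂ (Set.range fun α : PDual k => rightOp n α) := by
  rw [← Finsupp.range_linearCombination, LinearMap.coe_range]
  have : (fun x : MonoidAlgebra ℂ (PDual k) => (rightAlg n k x).unop) =
      ⇑(Finsupp.linearCombination ℂ fun α => rightOp n α) ∘ MonoidAlgebra.coeffEquiv :=
    funext unop_rightAlg_eq
  rw [this, EquivLike.range_comp]

/-- The centralizer of a family of operators is the span of a commuting family, if this holds for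
the matrices of the operators. -/
theorem centralizer_eq_span {ι κ : Type*} {f : ι → Module.End ℂ (TensorU n k)}
    {g : κ → Module.End ℂ (TensorU n k)} (hfg : ∀ a b, Commute (f a) (g b))
    (h : ∀ A, (∀ a, LinearMap.toMatrixAlgEquiv (basisT n k) (f a) * A =
        A * LinearMap.toMatrixAlgEquiv (basisT n k) (f a)) →
      A ∈ Submodule.span ℂ
        (Set.range fun b => LinearMap.toMatrixAlgEquiv (basisT n k) (g b))) :
    Set.centralizer (Set.range f) = Submodule.span ℂ (Set.range g) := by
  apply Set.Subset.antisymm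
  · intro T hT
    have hA := h (LinearMap.toMatrixAlgEquiv (basisT n k) T) fun a => by
      rw [← map_mul, ← map_mul, hT (f a) ⟨a, rfl⟩]
    have hr : (Set.range fun b => LinearMap.toMatrixAlgEquiv (basisT n k) (g b)) =
        (LinearMap.toMatrixAlgEquiv (basisT n k)).toLinearMap '' Set.range g := by
      rw [← Set.range_comp]; rfl
    rw [hr, Submodule.span_image] at hA
    obtain ⟨T', hT', he⟩ := hA
    rwa [← (LinearMap.toMatrixAlgEquiv (basisT n k)).injective he]
  · intro T hT
    have : Submodule.span ℂ (Set.range g) ≤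
        Subalgebra.toSubmodule (Subalgebra.centralizer ℂ (Set.range f)) := by
      rw [Submodule.span_le]
      rintro _ ⟨b, rfl⟩ _ ⟨a, rfl⟩
      exact hfg a b
    exact this hT

end Operators

/-! ### Duality -/

section Duality

variable {n k : ℕ}

/-- Compatible tuples have the same nonzero values, so a partial injection applicable to one is
applicable to the other; it keeps zeros and equalities, hence compatibility. -/
theorem exists_lRel_compat_iff (σ : PEquiv (Fin n) (Fin n)) (α : PDual k)
    (i l : Fin k → Option (Fin n)) :
    (∃ m, LRel σ i m ∧ PDual.Compat none α m l) ↔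
      ∃ m, PDual.Compat none α i m ∧ LRel σ m l := by
  constructor
  · rintro ⟨m, hm, hc⟩
    obtain ⟨j, hj⟩ := hm.symm.exists_image (v := l) fun b hb => hc.exists_left hb
    have h := lRel_sumElim.2 ⟨hm.symm, hj⟩
    exact ⟨j, hc.of_factor (fun x => (h.eq_none_iff x).1) fun x y => (h.eq_iff x y).1, hj.symm⟩
  · rintro ⟨m, hc, hm⟩
    obtain ⟨j, hj⟩ := hm.exists_image (v := i) fun a ha => hc.exists_right ha
    have h := lRel_sumElim.2 ⟨hj, hm⟩
    exact ⟨j, hj, hc.of_factor (fun x => (h.eq_none_iff x).1) fun x y => (h.eq_iff x y).1⟩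

theorem commute_leftRep_rightOp (σ : SymInv n) (α : PDual k) :
    Commute (leftRep n k σ) (rightOp n α) := by
  have h : Commute (LinearMap.toMatrixAlgEquiv (basisT n k) (leftRep n k σ))
      (LinearMap.toMatrixAlgEquiv (basisT n k) (rightOp n α)) := by
    rw [toMatrix_leftRep, toMatrix_rightOp]
    exact relMatrix_commute (isPartialInj_LRel _) (PDual.isPartialInj_compat _ _)
      fun i l => exists_lRel_compat_iff σ α i l
  apply (LinearMap.toMatrixAlgEquiv (basisT n k)).injective
  rw [map_mul, map_mul, h.eq]

theorem mem_span_of_commute_lRel {A : Matrix (Fin k → Option (Fin n)) (Fin k → Option (Fin n)) ℂ}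
    (hA : ∀ σ : SymInv n, relMatrix (LRel σ) * A = A * relMatrix (LRel σ)) :
    A ∈ Submodule.span ℂ
      (Set.range fun α : PDual k => relMatrix (PDual.Compat (none : Option (Fin n)) α)) := by
  classical
  apply mem_span_relMatrix fun α i l h => ⟨_, PDual.Compat.isLeastRel_levels h⟩
  · intro i l hne
    have hid : ∀ w : Fin k → Option (Fin n), ∃ σ : PEquiv (Fin n) (Fin n), LRel σ w w ∧
        ∀ x y, y ∈ σ x → ∃ s, w s = some x ∧ w s = some y :=
      fun w => exists_lRel (fun _ => Iff.rfl) fun _ _ => Iff.rfl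
    refine ⟨_, PDual.compat_levels (fun a ha => ?_) fun b hb => ?_⟩
    -- Here `σ` is the partial identity on the nonzero entries of `l`. It fixes `l`, so a nonzero
    -- entry of `A` forces it to be defined on the nonzero entries of `i`.
    · obtain ⟨σ, hσ, hd⟩ := hid l
      obtain ⟨j, hj⟩ := exists_rel_from_of_commute (isPartialInj_LRel σ) (hA σ) hσ hne
      rcases hj a with ⟨h, -⟩ | ⟨x, y, hx, -, hxy⟩
      · exact (ha h).elim
      · obtain ⟨s, hs, -⟩ := hd x y hxy
        exact ⟨s, hs.trans hx.symm⟩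
    · obtain ⟨σ, hσ, hd⟩ := hid i
      obtain ⟨j, hj⟩ := exists_rel_to_of_commute (isPartialInj_LRel σ) (hA σ) hσ hne
      rcases hj b with ⟨-, h⟩ | ⟨x, y, -, hy, hxy⟩
      · exact (hb h).elim
      · obtain ⟨s, -, hs⟩ := hd x y hxy
        exact ⟨s, hs.trans hy.symm⟩
  · intro i l i' l' α h h'
    have hl := PDual.Compat.isLeastRel_levels ((h α).2 le_rfl)
    have hl' := PDual.Compat.isLeastRel_levels ((h' α).2 le_rfl)
    have e := hl.unique h
    have e' := hl'.unique h'
    have c := (h α).2 le_rfl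
    have c' := (h' α).2 le_rfl
    -- Equal level-set partitions give the joined tuples the same zeros and equalities, so a single
    -- `σ` carries the pair `(i, l)` to `(i', l')`.
    obtain ⟨a0, a1⟩ := c.compat_levels.factor_levels (e ▸ c')
    obtain ⟨b0, b1⟩ := c'.compat_levels.factor_levels (e' ▸ c)
    obtain ⟨σ, hσ, -⟩ := exists_lRel (w := Sum.elim i l) (w' := Sum.elim i' l')
      (fun s => ⟨a0 s, b0 s⟩) fun s t => ⟨a1 s t, b1 s t⟩
    rw [lRel_sumElim] at hσ
    exact apply_eq_of_commute (isPartialInj_LRel σ) (hA σ) hσ.1 hσ.2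

theorem mem_span_of_commute_compat
    {A : Matrix (Fin k → Option (Fin n)) (Fin k → Option (Fin n)) ℂ}
    (hA : ∀ α : PDual k, relMatrix (PDual.Compat none α) * A =
      A * relMatrix (PDual.Compat none α)) :
    A ∈ Submodule.span ℂ
      (Set.range fun σ : SymInv n => relMatrix (LRel (S := Fin k) σ)) := by
  apply mem_span_relMatrix fun σ i l h => exists_isLeastRel_lRel σ i l h
  · intro i j hne
    -- The level-set partition of `i` with itself fixes `i`; through the nonzero entry of `A` it
    -- forces the zeros and equalities of `i` on `j`. The partition of `j` gives the converse.
    have hi := PDual.compat_levels_self none i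
    have hj := PDual.compat_levels_self none j
    obtain ⟨m, hm⟩ := exists_rel_to_of_commute (PDual.isPartialInj_compat _ _) (hA _) hi hne
    obtain ⟨m', hm'⟩ := exists_rel_from_of_commute (PDual.isPartialInj_compat _ _) (hA _) hj hne
    obtain ⟨a0, a1⟩ := hi.factor_levels hm
    obtain ⟨b0, b1⟩ := hj.factor_levels hm'
    obtain ⟨σ, hσ, -⟩ := exists_lRel (w := i) (w' := j)
      (fun s => ⟨a0 (Sum.inr s), b0 (Sum.inl s)⟩)
      fun s t => ⟨a1 (Sum.inr s) (Sum.inr t), b1 (Sum.inl s) (Sum.inl t)⟩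
    exact ⟨σ, hσ⟩
  · intro i j i' j' σ h h'
    have c := (h σ).2 le_rfl
    have c' := (h' σ).2 le_rfl
    -- A least `σ` is defined only on the nonzero entries of `i`, so any other tuple it moves takes
    -- its nonzero values among them.
    have hsupp : ∀ {i j i' j' : Fin k → Option (Fin n)},
        IsLeastRel (fun σ : SymInv n => LRel (S := Fin k) σ) σ i j → LRel σ i' j' →
        ∀ a, i' a ≠ none → ∃ b, i b = i' a := by
      intro i j i' j' h c' a ha
      obtain ⟨τ, hτ, -, hd⟩ := LRel.exists_least ((h σ).2 le_rfl)
      rcases c'.mono ((h τ).1 hτ) a with ⟨h, -⟩ | ⟨x, y, hx, -, hxy⟩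
      · exact (ha h).elim
      · obtain ⟨s, hs, -⟩ := hd x y hxy
        exact ⟨s, hs.trans hx.symm⟩
    have hi : PDual.Compat none (PDual.levels none i i') i i' :=
      PDual.compat_levels (hsupp h' c) (hsupp h c')
    have hs : LRel σ (Sum.elim i i') (Sum.elim j j') := lRel_sumElim.2 ⟨c, c'⟩
    -- The same `σ` sends `i` to `j` and `i'` to `j'`, so the partition taking `i` to `i'` also
    -- takes `j` to `j'`.
    have hj : PDual.Compat none (PDual.levels none i i') j j' :=
      hi.of_factor (fun x => (hs.eq_none_iff x).1) fun x y => (hs.eq_iff x y).1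
    exact apply_eq_of_commute (PDual.isPartialInj_compat _ _) (hA _) hi hj

end Duality

/-! ### Faithfulness of the semigroups and of their algebras -/

section Faithful

variable {n k : ℕ}

theorem leftRep_injective (hk : 0 < k) : Function.Injective (leftRep n k) := by
  intro σ τ h
  have h' : relMatrix (LRel (S := Fin k) σ) = relMatrix (LRel (S := Fin k) τ) := by
    rw [← toMatrix_leftRep, h, toMatrix_leftRep]
  have h'' := relMatrix_injective h'
  -- Constant tuples detect the graph of `σ`, provided there is at least one position.
  have hmem : ∀ (σ : PEquiv (Fin n) (Fin n)) x y, y ∈ σ x ↔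
      LRel (S := Fin k) σ (fun _ => some x) fun _ => some y := by
    intro σ x y
    constructor
    · exact fun hxy _ => Or.inr ⟨x, y, rfl, rfl, hxy⟩
    · intro h
      rcases h ⟨0, hk⟩ with ⟨h, -⟩ | ⟨x', y', hx, hy, hxy⟩
      · simp at h
      · cases hx; cases hy; exact hxy
  have hle : ∀ x y, y ∈ (show PEquiv (Fin n) (Fin n) from σ) x ↔
      y ∈ (show PEquiv (Fin n) (Fin n) from τ) x := by
    intro x y
    rw [hmem, hmem]
    exact iff_of_eq (congrFun (congrFun h'' _) _)
  exact PEquiv.ext fun x => Option.ext fun y => hle x y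

theorem rightRep_injective (hn : 0 < n) : Function.Injective (rightRep n k) := by
  classical
  intro α β h
  have h' : relMatrix (PDual.Compat (none : Option (Fin n)) α) =
      relMatrix (PDual.Compat (none : Option (Fin n)) β) := by
    rw [← toMatrix_rightOp, ← toMatrix_rightOp]
    exact congrArg _ (MulOpposite.op_injective h)
  have h'' := relMatrix_injective h'
  -- Truth values embed into the indices with `False` going to the zero index; such two-valued
  -- tuples already determine a partition.
  let φ : Prop → Option (Fin n) := fun p => if p then some ⟨0, hn⟩ else none
  have hφ : Function.Injective φ := by
    intro p q hpq
    by_cases hp : p <;> by_cases hq : q <;> simp_all [φ]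
  have h0 : φ False = none := if_neg id
  have key : ∀ (α : PDual k) (i l : Fin k → Prop), PDual.Compat False α i l ↔
      PDual.Compat none α (φ ∘ i) (φ ∘ l) := by
    intro α i l
    constructor
    · intro h
      refine h.of_factor (fun x hx => ?_) fun x y hxy => ?_ <;> rw [← Sum.comp_elim]
      · rw [Function.comp_apply, hx, h0]
      · rw [Function.comp_apply, hxy, Function.comp_apply]
    · intro h
      refine h.of_factor (fun x hx => ?_) fun x y hxy => ?_
      · rw [← Sum.comp_elim, Function.comp_apply, ← h0] at hx
        exact hφ hx
      · rw [← Sum.comp_elim] at hxy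
        exact hφ hxy
  apply PDual.ext_compat
  intro i l
  rw [key, key]
  exact iff_of_eq (congrFun (congrFun h'' _) _)

theorem leftAlg_injective_iff_le : Function.Injective (leftAlg n k) ↔ n ≤ k := by
  classical
  rw [leftAlg_injective_iff,
    linearIndependent_relMatrix_iff fun σ i l h => exists_isLeastRel_lRel σ i l h]
  constructor
  · intro h
    -- The identity can be least for a pair only if all `n` values occur among the `k` entries of
    -- `i`.
    obtain ⟨i, l, hil⟩ := h 1
    obtain ⟨τ, hτ, -, hd⟩ := LRel.exists_least ((hil 1).2 le_rfl)
    have hle : PEquiv.refl (Fin n) ≤ τ := (hil τ).1 hτ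
    have hs : ∀ x, ∃ a, i a = some x := fun x => by
      obtain ⟨a, ha, -⟩ := hd x x (hle x x rfl)
      exact ⟨a, ha⟩
    choose f hf using hs
    have hinj : Function.Injective f := fun x y hxy =>
      Option.some.inj ((hf x).symm.trans ((congrArg i hxy).trans (hf y)))
    simpa using Fintype.card_le_of_injective f hinj
  · intro hnk σ
    let s : PEquiv (Fin n) (Fin n) := σ
    -- Position `x` carries the value `x` for `x` in the domain of `σ`, and zero elsewhere, so the
    -- entries list exactly the domain.
    let i : Fin k → Option (Fin n) := fun a =>
      if h : ∃ x : Fin n, Fin.castLE hnk x = a ∧ (s x).isSome then some h.choose else none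
    have hi : ∀ a x, i a = some x → (s x).isSome := by
      intro a x h
      simp only [i] at h
      split_ifs at h with h'
      rw [← Option.some.inj h]
      exact h'.choose_spec.2
    have hi' : ∀ x, (s x).isSome → i (Fin.castLE hnk x) = some x := by
      intro x hx
      have h' : ∃ y : Fin n, Fin.castLE hnk y = Fin.castLE hnk x ∧ (s y).isSome := ⟨x, rfl, hx⟩
      simp only [i]
      rw [dif_pos h']
      exact congrArg some (Fin.castLE_injective hnk h'.choose_spec.1)
    obtain ⟨l, hl⟩ := exists_lRel_of_forall (σ := s) (w := i) fun a x h =>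
      Option.isSome_iff_exists.1 (hi a x h)
    refine ⟨i, l, fun τ => ⟨fun hτ => ?_, fun h => hl.mono h⟩⟩
    show s ≤ (show PEquiv (Fin n) (Fin n) from τ)
    rw [PEquiv.le_def]
    intro x y hxy
    have hx := hi' x (Option.isSome_iff_exists.2 ⟨y, hxy⟩)
    rcases hl (Fin.castLE hnk x) with ⟨h, -⟩ | ⟨x₁, y₁, hx₁, hy₁, h₁⟩
    · simp [hx] at h
    rcases hτ (Fin.castLE hnk x) with ⟨h, -⟩ | ⟨x₂, y₂, hx₂, hy₂, h₂⟩
    · simp [hx] at h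
    obtain rfl := Option.some.inj (hx.symm.trans hx₁)
    obtain rfl := Option.some.inj (hx.symm.trans hx₂)
    obtain rfl := Option.some.inj (hy₁.symm.trans hy₂)
    rwa [Option.mem_unique hxy h₁]

theorem rightAlg_injective_iff_le : Function.Injective (rightAlg n k) ↔ k ≤ n := by
  classical
  rw [rightAlg_injective_iff,
    linearIndependent_relMatrix_iff fun α i l h => ⟨_, PDual.Compat.isLeastRel_levels h⟩]
  constructor
  · intro h
    obtain ⟨i, l, hil⟩ := h 1
    obtain rfl := PDual.compat_one.1 ((hil 1).2 le_rfl)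
    have hc := PDual.compat_levels_self none i
    have hle := (hil _).1 hc
    -- Testing `1 ≤ levels none i i` on the indicator of each single position shows that the entries
    -- of `i` are nonzero and pairwise distinct.
    have hf := fun a => hc.factor_levels
      (hle (fun b => b = a) (fun b => b = a) (PDual.compat_one.2 rfl))
    have h0 : ∀ a, ∃ x, i a = some x := by
      intro a
      refine Option.ne_none_iff_exists'.1 fun ha => ?_
      exact ((hf a).1 (Sum.inl a) ha).mp rfl
    choose f hf' using h0
    have hinj : Function.Injective f := by
      intro a b hab
      have := (hf b).2 (Sum.inl a) (Sum.inl b)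
        ((hf' a).trans ((congrArg some hab).trans (hf' b).symm))
      exact this.mpr rfl
    simpa using Fintype.card_le_of_injective f hinj
  · intro hkn α
    -- Each block is labelled by one of its unprimed points, so `k` labels suffice and distinct
    -- blocks get distinct labels.
    choose r hr using α.left
    let w : Pt k → Option (Fin n) := fun x =>
      if h : ∃ B ∈ α.blocks, x ∈ B then some (Fin.castLE hkn (r h.choose h.choose_spec.1))
      else none
    have hw : ∀ B (hB : B ∈ α.blocks) x, x ∈ B → w x = some (Fin.castLE hkn (r B hB)) := by
      intro B hB x hx
      have h : ∃ B ∈ α.blocks, x ∈ B := ⟨B, hB, hx⟩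
      have e := α.disjoint _ h.choose_spec.1 B hB x h.choose_spec.2 hx
      simp only [w]
      rw [dif_pos h]
      congr 3
    have hw0 : ∀ x, x ∉ α.support → w x = none := fun x hx =>
      dif_neg fun ⟨B, hB, hxB⟩ => hx ⟨B, hB, hxB⟩
    have he : Sum.elim (fun a => w (Sum.inl a)) (fun b => w (Sum.inr b)) = w :=
      Sum.elim_comp_inl_inr w
    have hc : PDual.Compat none α (fun a => w (Sum.inl a)) (fun b => w (Sum.inr b)) := by
      constructor
      · intro B hB x hx y hy
        rw [he, hw B hB x hx, hw B hB y hy]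
      · intro x hx
        rw [he, hw0 x hx]
    -- Equal labels mean the same block, or both points outside all blocks, so every pair compatible
    -- with `α` factors through the labelling `w`.
    refine ⟨_, _, fun β => ⟨fun hβ i l h => hβ.of_factor (fun x hx => ?_) fun x y hxy => ?_,
      fun h => hc.of_le h⟩⟩
    · apply h.2
      rintro ⟨B, hB, hxB⟩
      rw [he, hw B hB x hxB] at hx
      cases hx
    · rw [he] at hxy
      by_cases hx : x ∈ α.support
      · obtain ⟨B, hB, hxB⟩ := hx
        by_cases hy : y ∈ α.support
        · obtain ⟨C, hC, hyC⟩ := hy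
          rw [hw B hB x hxB, hw C hC y hyC] at hxy
          have e := Fin.castLE_injective hkn (Option.some.inj hxy)
          have hBC := α.disjoint B hB C hC _ (hr B hB) (e ▸ hr C hC)
          subst hBC
          exact h.1 B hB x hxB y hyC
        · rw [hw B hB x hxB, hw0 y hy] at hxy
          cases hxy
      · by_cases hy : y ∈ α.support
        · obtain ⟨C, hC, hyC⟩ := hy
          rw [hw0 x hx, hw C hC y hyC] at hxy
          cases hxy
        · rw [h.2 x hx, h.2 y hy]

end Faithful

end RookDuality

theorem theorem2 (n k : ℕ) (hn : 0 < n) (hk : 0 < k) :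
    (∀ (σ : RookDuality.SymInv n) (α : RookDuality.PDual k),
      Commute (RookDuality.leftRep n k σ) (RookDuality.rightRep n k α).unop) ∧
    Set.centralizer (Set.range fun σ : RookDuality.SymInv n => RookDuality.leftRep n k σ) =
      Set.range (fun x : MonoidAlgebra ℂ (RookDuality.PDual k) =>
        (RookDuality.rightAlg n k x).unop) ∧
    Set.centralizer (Set.range fun α : RookDuality.PDual k =>
        (RookDuality.rightRep n k α).unop) =
      Set.range (fun x : MonoidAlgebra ℂ (RookDuality.SymInv n) =>
        RookDuality.leftAlg n k x) ∧
    Function.Injective (RookDuality.leftRep n k) ∧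
    Function.Injective (RookDuality.rightRep n k) ∧
    (Function.Injective (RookDuality.leftAlg n k) ↔ n ≤ k) ∧
    (Function.Injective (RookDuality.rightAlg n k) ↔ k ≤ n) := by
  refine ⟨fun σ α => RookDuality.commute_leftRep_rightOp σ α, ?_, ?_,
    RookDuality.leftRep_injective hk, RookDuality.rightRep_injective hn,
    RookDuality.leftAlg_injective_iff_le, RookDuality.rightAlg_injective_iff_le⟩
  · rw [RookDuality.range_rightAlg]
    refine RookDuality.centralizer_eq_span RookDuality.commute_leftRep_rightOp fun A hA => ?_
    simp only [RookDuality.toMatrix_leftRep] at hA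
    simp only [RookDuality.toMatrix_rightOp]
    exact RookDuality.mem_span_of_commute_lRel hA
  · rw [RookDuality.range_leftAlg]
    refine RookDuality.centralizer_eq_span (f := fun α : RookDuality.PDual k =>
      RookDuality.rightOp n α) (fun α σ => (RookDuality.commute_leftRep_rightOp σ α).symm)
      fun A hA => ?_
    simp only [RookDuality.toMatrix_rightOp] at hA
    simp only [RookDuality.toMatrix_leftRep]
    exact RookDuality.mem_span_of_commute_compat hA
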